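/- Let $X$ be a compact connected Riemann surface, $S=\{x_1,\dots,x_n\}\subset X$ a finite set of distinct points (also regarded as a reduced divisor), and $E_*$ a parabolic vector bundle on $X$ with parabolic structure over $S$: a holomorphic vector bundle $E$ of finite rank on $X$ together with, for each $i$, a filtration $E_{x_i}=E_{i,1}\supset E_{i,2}\supset\cdots\supset E_{i,l_i}\supset E_{i,l_i+1}=0$ of the fibre by subspaces and real weights $0\le\alpha_{i,1}<\cdots<\alpha_{i,l_i}<1$. Let $\mathcal E_{i,j}\subset E$ be the subsheaf of holomorphic sections $s$ with $s(x_i)\in E_{i,j}$. Let $\mathrm{Diff}^1_P(E,E)$ be the sheaf of holomorphic differential operators $E\to E$ of order at most one that map every $\mathcal E_{i,j}$, $1\le i\le n$, $1\le j\le l_i$, into itself, and let $\mathrm{At}(E_*)\subset\mathrm{Diff}^1_P(E,E)$ be the subsheaf of those operators whose principal symbol is of the form $\mathrm{Id}_E\otimes v$ with $v$ a section of $TX(-S)=TX\otimes\mathcal O_X(-S)\subset TX$. The symbol gives the parabolic Atiyah exact sequence $$0\longrightarrow \mathrm{End}^P(E_*)\longrightarrow \mathrm{At}(E_*)\stackrel{\sigma}{\longrightarrow}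 TX(-S)\longrightarrow 0,$$ where $\mathrm{End}^P(E_*)$ is the sheaf of endomorphisms of $E$ preserving all $\mathcal E_{i,j}$. A holomorphic splitting of it is an $\mathcal O_X$-linear homomorphism $\mathbf h:TX(-S)\to\mathrm{At}(E_*)$ with $\sigma\circ\mathbf h=\mathrm{Id}$. A logarithmic connection on $E$ singular over $S$ is a $\mathbb C$-linear sheaf homomorphism $D:E\to E\otimes K_X\otimes\mathcal O_X(S)$ with $D(fs)=fD(s)+s\otimes df$ for all local holomorphic functions $f$ and sections $s$; its residue $\mathrm{Res}(D,x_i):E_{x_i}\to E_{x_i}$ sends $s(x_i)$ to the value of $D(s)$ at $x_i$, where $(K_X\otimes\mathcal O_X(S))_{x_i}$ is identified with $\mathbb C$ by $\frac{dz}{z}(x_i)\mapsto 1$ for a holomorphic coordinate $z$ with $z(x_i)=0$. Then giving a holomorphic splitting $\mathbf h$ of the parabolic Atiyah exact sequence is equivalent to giving a logarithmic connection $D$ on $E$ singular over $S$ such that $\mathrm{Res}(D,x_i)(E_{i,j})\subset E_{i,j}$ for all $1\le i\le n$ and $1\le j\le l_i$: there is a bijection $\mathbf h\leftrightarrow D$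 between the holomorphic splittings and these logarithmic connections, characterized by $\mathbf h(v)(s)=\langle D(s),v\rangle$ for all local sections $v$ of $TX(-S)$ and $s$ of $E$. -/

import Mathlib

open TopologicalSpace Bundle FiberBundle
open scoped Manifold ContDiff Topology

noncomputable section

namespace ParabolicAtiyah

section Sections

variable {X : Type*} [TopologicalSpace X] [ChartedSpace ℂ X]

/-- The algebra of functions on `X` whose restriction to the open set `U` is holomorphic.
It acts on sections over `U` through the restrictions to `U`; the values of such a function
outside `U` are irrelevant everywhere below. -/
def Hol (U : Opens X) : Subalgebra ℂ (X → ℂ) where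
  carrier := {f | ContMDiffOn 𝓘(ℂ) 𝓘(ℂ) ω f (U : Set X)}
  mul_mem' hf hg := hf.mul hg
  add_mem' hf hg := hf.add hg
  algebraMap_mem' _ := contMDiffOn_const

/-- Restriction of holomorphic functions to a smaller open set. -/
def resHol {U W : Opens X} (h : W ≤ U) (f : Hol U) : Hol W :=
  ⟨f.1, ContMDiffOn.mono f.2 h⟩

variable (F : Type*) [NormedAddCommGroup F] [NormedSpace ℂ F]
  (E : X → Type*) [TopologicalSpace (TotalSpace F E)]
  [∀ x, AddCommGroup (E x)] [∀ x, Module ℂ (E x)] [∀ x, TopologicalSpace (E x)]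
  [FiberBundle F E]

/-- A (set-theoretic) section `s` of `E` is holomorphic on the set `A`. -/
def IsHolOn (s : ∀ x, E x) (A : Set X) : Prop :=
  ContMDiffOn 𝓘(ℂ) (𝓘(ℂ).prod 𝓘(ℂ, F)) ω (fun x => TotalSpace.mk' F x (s x)) A

variable [VectorBundle ℂ F E] [ContMDiffVectorBundle ω F E 𝓘(ℂ)]

/-- `Γ(U, E)`: the holomorphic sections of `E` over the open set `U`. A section over `U` is
recorded by its extension by zero to `X`, so that two of them are equal exactly when they agree
at every point of `U`. -/
def Sec (U : Opens X) : Submodule ℂ (∀ x, E x) where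
  carrier := {s | IsHolOn F E s U ∧ ∀ x, x ∉ U → s x = 0}
  add_mem' hs ht := ⟨hs.1.add_section ht.1, fun x hx => by simp [hs.2 x hx, ht.2 x hx]⟩
  zero_mem' := ⟨(contMDiff_zeroSection ℂ E).contMDiffOn, fun _ _ => rfl⟩
  smul_mem' c _ hs := ⟨hs.1.const_smul_section (a := c), fun x hx => by simp [hs.2 x hx]⟩

variable {F E}

open Classical in
/-- Restriction of sections to a smaller open set. -/
def resSec {U W : Opens X} (h : W ≤ U) (s : Sec F E U) : Sec F E W :=
  ⟨fun x => if x ∈ W then s.1 x else 0,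
    (ContMDiffOn.mono s.2.1 h).congr fun x hx => by
      simp only [if_pos (show x ∈ W from hx)], fun _ hx => if_neg hx⟩

instance (U : Opens X) : SMul (Hol U) (Sec F E U) where
  smul f s := ⟨fun x => f.1 x • s.1 x,
    ContMDiffOn.smul_section f.2 s.2.1, fun x hx => by simp [s.2.2 x hx]⟩

/-- The `𝒪(U)`-module structure on `Γ(U, E)`. -/
instance (U : Opens X) : Module (Hol U) (Sec F E U) where
  one_smul s := Subtype.ext (funext fun x => one_smul ℂ (s.1 x))
  mul_smul f g s := Subtype.ext (funext fun x => mul_smul (f.1 x) (g.1 x) (s.1 x))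
  smul_zero f := Subtype.ext (funext fun x => smul_zero (f.1 x))
  smul_add f s t := Subtype.ext (funext fun x => smul_add (f.1 x) (s.1 x) (t.1 x))
  add_smul f g s := Subtype.ext (funext fun x => add_smul (f.1 x) (g.1 x) (s.1 x))
  zero_smul s := Subtype.ext (funext fun x => zero_smul ℂ (s.1 x))

/-- Multiplication by a holomorphic function, as a `ℂ`-linear map on sections. -/
def mulHol {U : Opens X} (f : Hol U) : Sec F E U →ₗ[ℂ] Sec F E U where
  toFun s := f • s
  map_add' s t := smul_add f s t
  map_smul' c s := Subtype.ext (funext fun x => smul_comm (f.1 x) c (s.1 x))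

variable (F E) in
/-- The domain of the preferred local trivialization of `E` at `p`. -/
def trivDomain (p : X) : Opens X :=
  ⟨(trivializationAt F E p).baseSet, (trivializationAt F E p).open_baseSet⟩

variable (F) in
/-- The holomorphic local section with value `e` at `p` that is constant in the preferred local
trivialization of `E` at `p`. It depends linearly on `e`. -/
def constSec (p : X) : E p →ₗ[ℂ] Sec F E (trivDomain F E p) where
  toFun e := ⟨fun x => (trivializationAt F E p).symmₗ ℂ x
      ((trivializationAt F E p).linearMapAt ℂ p e), by
    constructor
    · refine ((trivializationAt F E p).contMDiffOn_section_baseSet_iff).2 ?_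
      refine (contMDiffOn_const (c := (trivializationAt F E p).linearMapAt ℂ p e)).congr ?_
      intro x hx
      have h1 := congrFun (Trivialization.coe_linearMapAt_of_mem (R := ℂ)
        (trivializationAt F E p) hx)
      exact (h1 _).symm.trans (Trivialization.linearMapAt_symmₗ _ hx _)
    · intro x hx
      exact congrArg (fun L : F →ₗ[ℂ] E x => L _) (dif_neg hx)⟩
  map_add' e e' := Subtype.ext (funext fun x => by simp only [map_add]; rfl)
  map_smul' c e := Subtype.ext (funext fun x => by simp only [map_smul]; rfl)

theorem constSec_apply_self (p : X) (e : E p) : (constSec F p e).1 p = e :=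
  Trivialization.symmₗ_linearMapAt (R := ℂ) (trivializationAt F E p)
    (mem_baseSet_trivializationAt F E p) e

end Sections

section DifferentialOperators

variable {X : Type*} [TopologicalSpace X] [ChartedSpace ℂ X]
  (F : Type*) [NormedAddCommGroup F] [NormedSpace ℂ F]
  (E : X → Type*) [TopologicalSpace (TotalSpace F E)]
  [∀ x, AddCommGroup (E x)] [∀ x, Module ℂ (E x)] [∀ x, TopologicalSpace (E x)]
  [FiberBundle F E] [VectorBundle ℂ F E] [ContMDiffVectorBundle ω F E 𝓘(ℂ)]

/-- Families of `ℂ`-linear operators on `Γ(W, E)`, one for each open `W ⊆ U`. -/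
def RawOp (U : Opens X) : Type _ :=
  ∀ W : {W : Opens X // W ≤ U}, Sec F E W.1 →ₗ[ℂ] Sec F E W.1

instance (U : Opens X) : AddCommGroup (RawOp F E U) :=
  inferInstanceAs (AddCommGroup (∀ W : {W : Opens X // W ≤ U}, Sec F E W.1 →ₗ[ℂ] Sec F E W.1))

instance (U : Opens X) : SMul (Hol U) (RawOp F E U) where
  smul f D := fun W => mulHol (resHol W.2 f) ∘ₗ D W

variable {F E}

/-- `(f D)(s) = f · D(s)`. -/
instance (U : Opens X) : Module (Hol U) (RawOp F E U) where
  one_smul D := funext fun W => LinearMap.ext fun s => one_smul (Hol W.1) (D W s)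
  mul_smul f g D := funext fun W => LinearMap.ext fun s =>
    mul_smul (resHol W.2 f) (resHol W.2 g) (D W s)
  smul_zero f := funext fun W => LinearMap.ext fun _ =>
    smul_zero (A := Sec F E W.1) (resHol W.2 f)
  smul_add f D D' := funext fun W => LinearMap.ext fun s =>
    smul_add (resHol W.2 f) (D W s) (D' W s)
  add_smul f g D := funext fun W => LinearMap.ext fun s =>
    add_smul (resHol W.2 f) (resHol W.2 g) (D W s)
  zero_smul D := funext fun W => LinearMap.ext fun s => zero_smul (Hol W.1) (D W s)

/-- Restriction of operators to a smaller open set. -/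
def resOp {U V : Opens X} (h : V ≤ U) (D : RawOp F E U) : RawOp F E V :=
  fun W => D ⟨W.1, W.2.trans h⟩

/-- The family is a morphism of sheaves `E|_U ⟶ E|_U`. -/
def IsSheafHom {U : Opens X} (D : RawOp F E U) : Prop :=
  ∀ (W : Opens X) (hW : W ≤ U) (V : Opens X) (hV : V ≤ W) (s : Sec F E W),
    D ⟨V, hV.trans hW⟩ (resSec hV s) = resSec hV (D ⟨W, hW⟩ s)

/-- The commutator `[D, f]`, for `f` holomorphic on `W ⊆ U`. The principal symbol `σ₀(D)`, a
section over `U` of `End(E) ⊗ TX`, is the `End(E)`-valued derivation `f ↦ [D, f]` of `𝒪_U`. -/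
def symbol {U : Opens X} (D : RawOp F E U) (W : Opens X) (h : W ≤ U) (f : Hol W)
    (s : Sec F E W) : Sec F E W :=
  D ⟨W, h⟩ (f • s) - f • D ⟨W, h⟩ s

/-- `D` is a differential operator of order at most one: all the commutators `[D, f]` are linear
over the holomorphic functions. -/
def IsOrderOne {U : Opens X} (D : RawOp F E U) : Prop :=
  ∀ (W : Opens X) (h : W ≤ U) (f g : Hol W) (s : Sec F E W),
    symbol D W h f (g • s) = g • symbol D W h f s

variable (F E) in
/-- `Γ(U, Diff¹(E, E))`: holomorphic differential operators `E|_U ⟶ E|_U` of order at most one,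
that is, `ℂ`-linear sheaf morphisms satisfying `IsOrderOne`. -/
def Diff1 (U : Opens X) : Submodule (Hol U) (RawOp F E U) where
  carrier := {D | IsSheafHom D ∧ IsOrderOne D}
  add_mem' := by
    rintro D D' ⟨h1, h2⟩ ⟨h1', h2'⟩
    refine ⟨fun W hW V hV s => ?_, fun W h f g s => ?_⟩
    · have e1 := congrArg Subtype.val (h1 W hW V hV s)
      have e2 := congrArg Subtype.val (h1' W hW V hV s)
      refine Subtype.ext (funext fun x => ?_)
      have e1 := congrFun e1 x
      have e2 := congrFun e2 x
      change (D ⟨V, _⟩ (resSec hV s)).1 x + (D' ⟨V, _⟩ (resSec hV s)).1 x = _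
      rw [e1, e2]
      by_cases hx : x ∈ V
      · simp only [resSec, if_pos hx]; rfl
      · simp only [resSec, if_neg hx, add_zero]
    · have e : ∀ t, symbol (D + D') W h f t = symbol D W h f t + symbol D' W h f t := by
        intro t
        change (D ⟨W, h⟩ (f • t) + D' ⟨W, h⟩ (f • t)) - f • (D ⟨W, h⟩ t + D' ⟨W, h⟩ t) = _
        rw [smul_add, symbol, symbol]; abel
      rw [e, e, h2, h2', smul_add]
  zero_mem' := by
    refine ⟨fun W hW V hV s => ?_, fun W h f g s => ?_⟩
    · refine Subtype.ext (funext fun x => ?_)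
      by_cases hx : x ∈ V
      · simp only [resSec, if_pos hx]; rfl
      · simp only [resSec, if_neg hx]; rfl
    · change (0 : Sec F E W) - f • (0 : Sec F E W) = g • ((0 : Sec F E W) - f • (0 : Sec F E W))
      simp
  smul_mem' := by
    rintro a D ⟨h1, h2⟩
    refine ⟨fun W hW V hV s => ?_, fun W h f g s => ?_⟩
    · have e1 := congrArg Subtype.val (h1 W hW V hV s)
      refine Subtype.ext (funext fun x => ?_)
      have e1 := congrFun e1 x
      change a.1 x • (D ⟨V, _⟩ (resSec hV s)).1 x = _
      rw [e1]
      by_cases hx : x ∈ V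
      · simp only [resSec, if_pos hx]; rfl
      · simp only [resSec, if_neg hx, smul_zero]
    · have e : ∀ t, symbol (a • D) W h f t = resHol h a • symbol D W h f t := by
        intro t
        change resHol h a • D ⟨W, h⟩ (f • t) - f • (resHol h a • D ⟨W, h⟩ t) = _
        rw [symbol, smul_sub, smul_comm f (resHol h a)]
      rw [e, e, h2, smul_comm]

end DifferentialOperators

section Tangent

variable {X : Type*} [TopologicalSpace X] [ChartedSpace ℂ X] [IsManifold 𝓘(ℂ) ω X]

/-- `Γ(U, TX ⊗ 𝒪_X(-S)) ⊆ Γ(U, TX)`: the holomorphic vector fields on `U` that vanish at the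
points of `S` lying in `U`. -/
def TanLog (S : Finset X) (U : Opens X) :
    Submodule (Hol U) (Sec ℂ (fun x : X => TangentSpace 𝓘(ℂ) x) U) where
  carrier := {v | ∀ p ∈ S, v.1 p = 0}
  add_mem' {v w} hv hw := fun p hp => by
    change v.1 p + w.1 p = 0
    rw [hv p hp, hw p hp, add_zero]
  zero_mem' := fun _ _ => rfl
  smul_mem' f v hv := fun p hp => by
    change f.1 p • v.1 p = 0
    rw [hv p hp, smul_zero]

instance (S : Finset X) (U : Opens X) : Module (Hol U) (TanLog S U) :=
  Submodule.module (TanLog S U)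

instance (S : Finset X) (U : Opens X) : SMul (Hol U) (TanLog S U) :=
  (Submodule.module (TanLog S U)).toSMul

/-- Restriction of vector fields vanishing on `S`. -/
def resTan {S : Finset X} {U W : Opens X} (h : W ≤ U) (v : TanLog S U) : TanLog S W :=
  ⟨resSec h v.1, fun p hp => by
    by_cases hx : p ∈ W
    · simp only [resSec, if_pos hx]; exact v.2 p hp
    · simp only [resSec, if_neg hx]⟩

end Tangent

section Parabolic

variable {X : Type*} (E : X → Type*) [∀ x, AddCommGroup (E x)] [∀ x, Module ℂ (E x)]

/-- A parabolic structure on `E` over the finite set `S`: for every `p ∈ S` a filtration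
`E_p = E_{p,1} ⊇ E_{p,2} ⊇ ⋯ ⊇ E_{p,l} ⊇ E_{p,l+1} = 0` and weights
`0 ≤ α_{p,1} < ⋯ < α_{p,l} < 1`. The indices start at `0` here, so that `flag p j` is
`E_{p,j+1}` and `weight p j` is `α_{p,j+1}`. -/
structure ParabolicStructure (S : Finset X) where
  len : S → ℕ
  flag : ∀ p : S, Fin (len p + 1) → Submodule ℂ (E p.1)
  flag_zero : ∀ p, flag p 0 = ⊤
  flag_last : ∀ p, flag p (Fin.last (len p)) = ⊥
  flag_anti : ∀ p, Antitone (flag p)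
  weight : ∀ p : S, Fin (len p) → ℝ
  weight_nonneg : ∀ p j, 0 ≤ weight p j
  weight_lt_one : ∀ p j, weight p j < 1
  weight_strictMono : ∀ p, StrictMono (weight p)

end Parabolic

section Atiyah

variable {X : Type*} [TopologicalSpace X] [ChartedSpace ℂ X] [IsManifold 𝓘(ℂ) ω X]
  {F : Type*} [NormedAddCommGroup F] [NormedSpace ℂ F]
  {E : X → Type*} [TopologicalSpace (TotalSpace F E)]
  [∀ x, AddCommGroup (E x)] [∀ x, Module ℂ (E x)] [∀ x, TopologicalSpace (E x)]
  [FiberBundle F E] [VectorBundle ℂ F E] [ContMDiffVectorBundle ω F E 𝓘(ℂ)]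
  {S : Finset X}

variable (F) in
/-- `Γ(U, 𝓔_{p,j})`, where `𝓔_{p,j}` is the kernel of `E ⟶ E_p / E_{p,j}`. -/
def FlagSec (P : ParabolicStructure E S) (p : S) (j : Fin (P.len p)) (U : Opens X) :
    Set (Sec F E U) :=
  {s | p.1 ∈ U → s.1 p.1 ∈ P.flag p j.castSucc}

/-- `D` maps every subsheaf `𝓔_{p,j}|_U` into itself. -/
def PreservesFlagSec (P : ParabolicStructure E S) {U : Opens X} (D : RawOp F E U) : Prop :=
  ∀ (p : S) (j : Fin (P.len p)) (W : Opens X) (h : W ≤ U),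
    ∀ s ∈ FlagSec F P p j W, D ⟨W, h⟩ s ∈ FlagSec F P p j W

variable (F) in
/-- `Γ(U, Diff¹_P(E, E))`: the operators in `Γ(U, Diff¹(E, E))` preserving all `𝓔_{p,j}`. -/
def Diff1P (P : ParabolicStructure E S) (U : Opens X) : Submodule (Hol U) (RawOp F E U) where
  carrier := {D | D ∈ Diff1 F E U ∧ PreservesFlagSec P D}
  add_mem' hD hD' := ⟨add_mem hD.1 hD'.1, fun p j W h s hs hp =>
    add_mem (hD.2 p j W h s hs hp) (hD'.2 p j W h s hs hp)⟩
  zero_mem' := ⟨zero_mem _, fun _ _ _ _ _ _ _ => zero_mem _⟩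
  smul_mem' f _ hD := ⟨Submodule.smul_mem _ f hD.1, fun p j W h s hs hp =>
    Submodule.smul_mem _ (f.1 p.1) (hD.2 p j W h s hs hp)⟩

/-- `σ₀(D) = Id_E ⊗ v` for a vector field `v`: `[D, f] = v(f) · Id_E` for every local
holomorphic function `f`. -/
def HasSymbol {U : Opens X} (D : RawOp F E U)
    (v : Sec ℂ (fun x : X => TangentSpace 𝓘(ℂ) x) U) : Prop :=
  ∀ (W : Opens X) (h : W ≤ U) (f : Hol W) (s : Sec F E W), ∀ x ∈ W,
    (symbol D W h f s).1 x = (mvfderiv 𝓘(ℂ) f.1 x (v.1 x)) • s.1 x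

theorem HasSymbol.add {U : Opens X} {D D' : RawOp F E U}
    {v w : Sec ℂ (fun x : X => TangentSpace 𝓘(ℂ) x) U} (h : HasSymbol D v)
    (h' : HasSymbol D' w) : HasSymbol (D + D') (v + w) := by
  intro W hW f s x hx
  have e1 := h W hW f s x hx
  have e2 := h' W hW f s x hx
  change (D ⟨W, hW⟩ (f • s)).1 x - f.1 x • (D ⟨W, hW⟩ s).1 x = _ at e1
  change (D' ⟨W, hW⟩ (f • s)).1 x - f.1 x • (D' ⟨W, hW⟩ s).1 x = _ at e2
  change ((D ⟨W, hW⟩ (f • s)).1 x + (D' ⟨W, hW⟩ (f • s)).1 x)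
    - f.1 x • ((D ⟨W, hW⟩ s).1 x + (D' ⟨W, hW⟩ s).1 x)
    = (mvfderiv 𝓘(ℂ) f.1 x (v.1 x + w.1 x)) • s.1 x
  rw [map_add, add_smul, ← e1, ← e2, smul_add]
  abel

theorem HasSymbol.smul {U : Opens X} {D : RawOp F E U}
    {v : Sec ℂ (fun x : X => TangentSpace 𝓘(ℂ) x) U} (a : Hol U) (h : HasSymbol D v) :
    HasSymbol (a • D) (a • v) := by
  intro W hW f s x hx
  have e1 := h W hW f s x hx
  change (D ⟨W, hW⟩ (f • s)).1 x - f.1 x • (D ⟨W, hW⟩ s).1 x = _ at e1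
  change a.1 x • (D ⟨W, hW⟩ (f • s)).1 x - f.1 x • (a.1 x • (D ⟨W, hW⟩ s).1 x)
    = (mvfderiv 𝓘(ℂ) f.1 x (a.1 x • v.1 x)) • s.1 x
  rw [(mvfderiv 𝓘(ℂ) f.1 x).map_smul, smul_assoc, ← e1, smul_sub, smul_comm (f.1 x)]

variable (F) in
/-- `Γ(U, At(E_*))`, where `At(E_*) = Diff¹_P(E, E) ∩ σ₀⁻¹(TX ⊗ 𝒪_X(-S))`. -/
def At (P : ParabolicStructure E S) (U : Opens X) : Submodule (Hol U) (RawOp F E U) where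
  carrier := {D | D ∈ Diff1P F P U ∧ ∃ v : TanLog S U, HasSymbol D v.1}
  add_mem' := by
    rintro D D' ⟨h, v, hv⟩ ⟨h', w, hw⟩
    exact ⟨add_mem h h', v + w, hv.add hw⟩
  zero_mem' := by
    refine ⟨zero_mem _, 0, fun W h f s x hx => ?_⟩
    change (0 : E x) - f.1 x • (0 : E x) = (mvfderiv 𝓘(ℂ) f.1 x 0) • s.1 x
    simp
  smul_mem' := by
    rintro a D ⟨h, v, hv⟩
    exact ⟨Submodule.smul_mem _ a h, ⟨a • v.1, Submodule.smul_mem _ a v.2⟩, hv.smul a⟩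

instance (P : ParabolicStructure E S) (U : Opens X) : Module (Hol U) (At F P U) :=
  Submodule.module (At F P U)

instance (P : ParabolicStructure E S) (U : Opens X) : SMul (Hol U) (At F P U) :=
  (Submodule.module (At F P U)).toSMul

variable (F) in
/-- A holomorphic splitting of `0 ⟶ End^P(E_*) ⟶ At(E_*) ⟶ TX ⊗ 𝒪_X(-S) ⟶ 0`: an
`𝒪_X`-linear morphism of sheaves `h : TX ⊗ 𝒪_X(-S) ⟶ At(E_*)` with `σ ∘ h = Id`. -/
structure AtiyahSplitting (P : ParabolicStructure E S) where
  app : ∀ U : Opens X, TanLog S U →ₗ[Hol U] At F P U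
  app_res : ∀ (U W : Opens X) (h : W ≤ U) (v : TanLog S U),
    (app W (resTan h v)).1 = resOp h (app U v).1
  symbol_app : ∀ (U : Opens X) (v : TanLog S U), HasSymbol (app U v).1 v.1

end Atiyah

section Logarithmic

variable {X : Type*} [TopologicalSpace X] [ChartedSpace ℂ X] [IsManifold 𝓘(ℂ) ω X]
  (F : Type*) [NormedAddCommGroup F] [NormedSpace ℂ F]
  (E : X → Type*) [TopologicalSpace (TotalSpace F E)]
  [∀ x, AddCommGroup (E x)] [∀ x, Module ℂ (E x)] [∀ x, TopologicalSpace (E x)]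
  [∀ x, IsTopologicalAddGroup (E x)] [∀ x, ContinuousSMul ℂ (E x)]
  [FiberBundle F E] [VectorBundle ℂ F E] [ContMDiffVectorBundle ω F E 𝓘(ℂ)]
  (S : Finset X)

/-- The holomorphic coordinate `z` centred at `p` given by the preferred chart at `p`. -/
def coord (p x : X) : ℂ := chartAt ℂ p x - chartAt ℂ p p

/-- An `E`-valued one-form `η` has at most a simple pole at `p`, with residue `e ∈ E_p`: the
form `z η` extends holomorphically across `p`, with value `dz ⊗ e` at `p`. In other words, `η`
is a section of `E ⊗ K_X ⊗ 𝒪_X(S)` near `p` whose value at `p` is `(dz / z)(p) ⊗ e`. -/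
def HasSimplePole (η : ∀ x : X, TangentSpace 𝓘(ℂ) x →L[ℂ] E x) (p : X) (e : E p) : Prop :=
  ∃ τ : ∀ x : X, TangentSpace 𝓘(ℂ) x →L[ℂ] E x,
    (∃ W : Opens X, p ∈ W ∧
      IsHolOn (ℂ →L[ℂ] F) (fun x : X => TangentSpace 𝓘(ℂ) x →L[ℂ] E x) τ W) ∧
    (∀ᶠ x in 𝓝[≠] p, τ x = coord p x • η x) ∧
    τ p = (mvfderiv 𝓘(ℂ) (coord p) p).smulRight e

/-- `Γ(U, E ⊗ K_X ⊗ 𝒪_X(S))`: a section is recorded by the pair consisting of the corresponding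
holomorphic `E`-valued one-form on `U \ S` (extended by zero), and of its values in the fibres
over the points `p` of `U ∩ S` (extended by zero), where `(E ⊗ K_X ⊗ 𝒪_X(S))_p` is identified
with `E_p` by means of `(dz / z)(p) ↦ 1`. The one-form determines the second component. -/
def LogForm (U : Opens X) :
    Submodule ℂ ((∀ x : X, TangentSpace 𝓘(ℂ) x →L[ℂ] E x) × (∀ x, E x)) where
  carrier := {η | IsHolOn (ℂ →L[ℂ] F) (fun x : X => TangentSpace 𝓘(ℂ) x →L[ℂ] E x) η.1
        ((U : Set X) \ S) ∧
      (∀ x, x ∉ (U : Set X) \ S → η.1 x = 0) ∧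
      (∀ p ∈ (U : Set X) ∩ S, HasSimplePole F E η.1 p (η.2 p)) ∧
      (∀ x, x ∉ (U : Set X) ∩ S → η.2 x = 0)}
  add_mem' := by
    rintro η θ ⟨h1, h2, h3, h4⟩ ⟨k1, k2, k3, k4⟩
    refine ⟨h1.add_section k1, fun x hx => ?_, fun p hp => ?_, fun x hx => ?_⟩
    · simp [h2 x hx, k2 x hx]
    · obtain ⟨τ, ⟨W, hW, hτ⟩, ha, hb⟩ := h3 p hp
      obtain ⟨τ', ⟨W', hW', hτ'⟩, ha', hb'⟩ := k3 p hp
      refine ⟨τ + τ', ⟨W ⊓ W', ⟨hW, hW'⟩, ?_⟩, ?_, ?_⟩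
      · exact (ContMDiffOn.mono hτ (fun x hx => hx.1)).add_section
          (ContMDiffOn.mono hτ' (fun x hx => hx.2))
      · filter_upwards [ha, ha'] with x hx hx'
        simp [hx, hx']
      · refine ContinuousLinearMap.ext fun t => ?_
        change τ p t + τ' p t = mvfderiv 𝓘(ℂ) (coord p) p t • (η.2 p + θ.2 p)
        rw [hb, hb', smul_add]
        rfl
    · simp [h4 x hx, k4 x hx]
  zero_mem' := by
    refine ⟨(contMDiff_zeroSection ℂ
      (fun x : X => TangentSpace 𝓘(ℂ) x →L[ℂ] E x)).contMDiffOn,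
      fun _ _ => rfl, fun p _ => ⟨0, ⟨⊤, trivial, ?_⟩, ?_, ?_⟩, fun _ _ => rfl⟩
    · exact (contMDiff_zeroSection ℂ
        (fun x : X => TangentSpace 𝓘(ℂ) x →L[ℂ] E x)).contMDiffOn
    · exact Filter.Eventually.of_forall fun x => by simp
    · ext
      simp
  smul_mem' := by
    rintro c η ⟨h1, h2, h3, h4⟩
    refine ⟨h1.const_smul_section (a := c), fun x hx => ?_, fun p hp => ?_, fun x hx => ?_⟩
    · simp [h2 x hx]
    · obtain ⟨τ, ⟨W, hW, hτ⟩, ha, hb⟩ := h3 p hp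
      refine ⟨c • τ, ⟨W, hW, hτ.const_smul_section (a := c)⟩, ?_, ?_⟩
      · filter_upwards [ha] with x hx
        simp [hx, smul_comm c]
      · refine ContinuousLinearMap.ext fun t => ?_
        change c • τ p t = mvfderiv 𝓘(ℂ) (coord p) p t • (c • η.2 p)
        rw [hb, smul_comm _ c]
        rfl
    · simp [h4 x hx]

/-- A logarithmic connection on `E` singular over `S`: a `ℂ`-linear morphism of sheaves
`D : E ⟶ E ⊗ K_X ⊗ 𝒪_X(S)` satisfying the Leibniz identity `D(f s) = f D(s) + s ⊗ df`.
Sections of `E ⊗ K_X ⊗ 𝒪_X(S)` are equal when they agree off `S`, so restriction and the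
Leibniz identity are expressed there. The Leibniz identity makes `D` a differential operator
of order one. -/
structure LogConnection where
  app : ∀ U : Opens X, Sec F E U →ₗ[ℂ] LogForm F E S U
  app_res : ∀ (U W : Opens X) (h : W ≤ U) (s : Sec F E U), ∀ x ∈ (W : Set X) \ S,
    (app W (resSec h s)).1.1 x = (app U s).1.1 x
  leibniz : ∀ (U : Opens X) (f : Hol U) (s : Sec F E U), ∀ x ∈ (U : Set X) \ S,
    (app U (f • s)).1.1 x = f.1 x • (app U s).1.1 x + (mvfderiv 𝓘(ℂ) f.1 x).smulRight (s.1 x)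

variable {F E S}

/-- The residue `Res(D, p) : E_p ⟶ E_p`: the value of `D(s)` in
`(E ⊗ K_X ⊗ 𝒪_X(S))_p = E_p`, for `s` a holomorphic section near `p` with the given value at
`p`. By the Leibniz identity, this value depends on `s` only through `s(p)`. -/
def LogConnection.residue (D : LogConnection F E S) (p : X) : E p →ₗ[ℂ] E p where
  toFun e := (D.app (trivDomain F E p) (constSec F p e)).1.2 p
  map_add' e e' := by rw [map_add, map_add]; rfl
  map_smul' c e := by rw [map_smul, map_smul]; rfl

/-- `Res(D, p)` maps `E_{p,j}` into itself, for all `p ∈ S` and all `1 ≤ j ≤ l_p`. -/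
def LogConnection.PreservesFlags (D : LogConnection F E S) (P : ParabolicStructure E S) : Prop :=
  ∀ (p : S) (j : Fin (P.len p)), ∀ e ∈ P.flag p j.castSucc,
    D.residue p.1 e ∈ P.flag p j.castSucc

end Logarithmic

end ParabolicAtiyah

end

/-! Everything is governed by the formula `h(v)(s) = ⟨D(s), v⟩`, which only has to be tested off
`S`: holomorphic sections are determined there by continuity (`Sec.ext_off`), and so are sections of
`E ⊗ K_X ⊗ 𝒪_X(S)`, including their values over `S` (`LogForm.ext_off`).

From `D` to `h`: near `p ∈ S` a field `v` vanishing at `p` is `z w` with `w` holomorphic, so `⟨D(s),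
v⟩ = ⟨z D(s), w⟩` extends across `p`, with value `dz(w(p)) • Res(D, p)(s(p))`. Off `S` the Leibniz
rule says that `s ↦ ⟨D(s), v⟩` has symbol `v`; at `p` both the commutator and `v` vanish. The flags
are preserved because the residue preserves them. This rests on `app_snd_eq_residue`: the value of
`D(s)` at `p` depends only on `s(p)`.

From `h` to `D`: by `𝒪_X`-linearity, `h(v)(s)(x)` depends on `v` only through `v(x)` when `x ∉ S`
(`app_apply_congr`), so `v(x) ↦ h(v)(s)(x)` is a one-form. Near any `p`, `z` times it equals `dz ⊗
h(z ∂/∂z)(s)`, which is holomorphic at `p`. Hence the pole is simple, and for `p ∈ S` the residue is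
the action of `h(z ∂/∂z)` on the fibre at `p`; it preserves the flags because `h(z ∂/∂z)` lies in
`At(E_*)`.

Since the formula determines each of `h` and `D` from the other, the two constructions are mutually
inverse. -/

set_option linter.unusedSectionVars false

namespace ParabolicAtiyah

/-! ### Local theory of holomorphic sections: continuity, extension, division by a coordinate -/

section Local

variable {X : Type*} [TopologicalSpace X] [ChartedSpace ℂ X]

/-- A chart would map an isolated point to an open singleton of `ℂ`. -/
theorem nhdsNE_neBot (p : X) : (𝓝[≠] p).NeBot := by
  refine ⟨fun h => ?_⟩
  have hp : IsOpen ({p} : Set X) := isOpen_singleton_iff_punctured_nhds p |>.2 h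
  have h1 := (chartAt ℂ p).isOpen_image_of_subset_source hp
    (Set.singleton_subset_iff.2 (mem_chart_source ℂ p))
  rw [Set.image_singleton] at h1
  exact not_isOpen_singleton _ h1

theorem coord_self (p : X) : coord p p = 0 := sub_self _

variable (F : Type*) [NormedAddCommGroup F] [NormedSpace ℂ F]
  (E : X → Type*) [TopologicalSpace (TotalSpace F E)]
  [∀ x, AddCommGroup (E x)] [∀ x, Module ℂ (E x)] [∀ x, TopologicalSpace (E x)]
  [FiberBundle F E]

/-- A section of `E` is holomorphic at a point. -/
def IsHolAt (s : ∀ x, E x) (p : X) : Prop :=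
  ContMDiffAt 𝓘(ℂ) (𝓘(ℂ).prod 𝓘(ℂ, F)) ω (fun x => TotalSpace.mk' F x (s x)) p

variable {F E}

theorem isHolOn_iff {s : ∀ x, E x} {A : Set X} (hA : IsOpen A) :
    IsHolOn F E s A ↔ ∀ x ∈ A, IsHolAt F E s x :=
  ⟨fun h _ hx => ContMDiffOn.contMDiffAt h (hA.mem_nhds hx),
    fun h x hx => ContMDiffAt.contMDiffWithinAt (h x hx)⟩

theorem IsHolAt.congr {s t : ∀ x, E x} {p : X} (h : IsHolAt F E s p)
    (hst : ∀ᶠ x in 𝓝 p, t x = s x) : IsHolAt F E t p :=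
  ContMDiffAt.congr_of_eventuallyEq h (hst.mono fun x hx => by simp only [hx])

variable [VectorBundle ℂ F E]

/-- Holomorphic sections that agree on a punctured neighbourhood of a point agree there. -/
theorem eq_of_eventually_nhdsNE {s t : ∀ x, E x} {p : X} (hs : IsHolAt F E s p)
    (ht : IsHolAt F E t p) (h : ∀ᶠ x in 𝓝[≠] p, s x = t x) : s p = t p := by
  have := nhdsNE_neBot p
  have e1 := ((contMDiffAt_section p).1 hs).continuousAt.tendsto.mono_left
    (nhdsWithin_le_nhds (s := {p}ᶜ))
  have e2 := ((contMDiffAt_section p).1 ht).continuousAt.tendsto.mono_left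
    (nhdsWithin_le_nhds (s := {p}ᶜ))
  have e3 := tendsto_nhds_unique (e1.congr' (h.mono fun x hx => by simp only [hx])) e2
  have hp := mem_baseSet_trivializationAt F E p
  have e4 := congrArg ((trivializationAt F E p).symm p) e3
  rwa [(trivializationAt F E p).symm_apply_apply_mk hp,
    (trivializationAt F E p).symm_apply_apply_mk hp] at e4

variable [ContMDiffVectorBundle ω F E 𝓘(ℂ)]

section Sec

theorem Sec.isHolAt {U : Opens X} (s : Sec F E U) {x : X} (hx : x ∈ U) : IsHolAt F E s.1 x :=
  (isHolOn_iff U.2).1 s.2.1 x hx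

theorem Sec.ext_on {U : Opens X} {s t : Sec F E U} (h : ∀ x ∈ U, s.1 x = t.1 x) : s = t := by
  refine Subtype.ext (funext fun x => ?_)
  by_cases hx : x ∈ U
  · exact h x hx
  · rw [s.2.2 x hx, t.2.2 x hx]

theorem resSec_apply {U W : Opens X} (h : W ≤ U) (s : Sec F E U) {x : X} (hx : x ∈ W) :
    (resSec h s).1 x = s.1 x := if_pos hx

theorem eventually_notMem [T2Space X] (S : Finset X) (p : X) : ∀ᶠ x in 𝓝[≠] p, x ∉ S := by
  have h : ((S : Set X) \ {p})ᶜ ∈ 𝓝 p :=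
    ((S.finite_toSet.subset Set.sdiff_subset).isClosed.isOpen_compl).mem_nhds (by simp)
  filter_upwards [mem_nhdsWithin_of_mem_nhds h, self_mem_nhdsWithin] with x hx h' hS
  exact hx ⟨hS, h'⟩

/-- A holomorphic section is determined by its restriction to the complement of `S`. -/
theorem Sec.ext_off [T2Space X] {S : Finset X} {U : Opens X} {s t : Sec F E U}
    (h : ∀ x ∈ (U : Set X) \ S, s.1 x = t.1 x) : s = t := by
  refine Sec.ext_on fun p hp => eq_of_eventually_nhdsNE (Sec.isHolAt s hp) (Sec.isHolAt t hp) ?_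
  filter_upwards [eventually_notMem S p, mem_nhdsWithin_of_mem_nhds (U.2.mem_nhds hp)]
    with x hx hU using h x ⟨hU, hx⟩

open Classical in
/-- A holomorphic section over `W \ S` that extends locally across the points of `S` extends
to `W`. -/
theorem exists_sec_extension [T2Space X] {S : Finset X} {W : Opens X} (σ : ∀ x, E x)
    (h1 : ∀ x ∈ (W : Set X) \ S, IsHolAt F E σ x)
    (h2 : ∀ p ∈ (W : Set X) ∩ S, ∃ t, IsHolAt F E t p ∧ ∀ᶠ x in 𝓝[≠] p, t x = σ x) :
    ∃ T : Sec F E W, ∀ x ∈ (W : Set X) \ S, T.1 x = σ x := by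
  choose! t ht hσ using h2
  -- At a point `x ∈ S` the value is that of the local extension `t x` chosen for `x` itself. As `S`
  -- is finite, a punctured neighbourhood of `x` misses `S`, and there `T` is `σ`, which agrees with
  -- `t x`.
  let T : ∀ x, E x := fun x => if x ∈ W then (if x ∈ S then t x x else σ x) else 0
  have hT : ∀ x ∈ (W : Set X) \ S, T x = σ x := fun x hx => by
    simp only [T]
    rw [if_pos (show x ∈ W from hx.1), if_neg (show x ∉ S from hx.2)]
  refine ⟨⟨T, (isHolOn_iff W.2).2 fun p hp => ?_, fun x hx => if_neg hx⟩, hT⟩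
  by_cases hS : p ∈ S
  · refine (ht p ⟨hp, hS⟩).congr ?_
    rw [← nhdsNE_sup_pure, Filter.eventually_sup, Filter.eventually_pure]
    constructor
    · filter_upwards [hσ p ⟨hp, hS⟩, eventually_notMem S p,
        mem_nhdsWithin_of_mem_nhds (W.2.mem_nhds hp)] with x hx hS hW
      rw [hT x ⟨hW, hS⟩, hx]
    · simp only [T]
      rw [if_pos (show p ∈ W from hp), if_pos hS]
  · refine (h1 p ⟨hp, hS⟩).congr ?_
    filter_upwards [W.2.mem_nhds hp, S.finite_toSet.isClosed.isOpen_compl.mem_nhds hS]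
      with x hW hS using hT x ⟨hW, hS⟩

end Sec

section Division

theorem contMDiffOn_chart_comp [IsManifold 𝓘(ℂ) ω X] {g : X → F} {p : X} {A : Set X}
    (hAs : A ⊆ (chartAt ℂ p).source) (hg : ContMDiffOn 𝓘(ℂ) 𝓘(ℂ, F) ω g A) :
    DifferentiableOn ℂ (g ∘ (chartAt ℂ p).symm) (chartAt ℂ p '' A) := by
  have h := hg.comp ((contMDiffOn_chart_symm (I := 𝓘(ℂ)) (n := ω) (x := p)).mono
    (show chartAt ℂ p '' A ⊆ _ by
      rintro _ ⟨x, hx, rfl⟩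
      exact (chartAt ℂ p).map_source (hAs hx))) (by
      rintro _ ⟨x, hx, rfl⟩
      simpa [(chartAt ℂ p).left_inv (hAs hx)] using hx)
  exact (contMDiffOn_iff_contDiffOn.1 h).differentiableOn (by simp)

/-- A holomorphic section that vanishes at `p` is divisible by the coordinate at `p`. -/
theorem exists_eq_coord_smul [IsManifold 𝓘(ℂ) ω X] [CompleteSpace F] {U : Opens X}
    (s : Sec F E U) {p : X} (hp : p ∈ U) (h0 : s.1 p = 0) :
    ∃ W : Opens X, p ∈ W ∧ W ≤ U ∧ (W : Set X) ⊆ (chartAt ℂ p).source ∧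
      ∃ t : Sec F E W, ∀ x ∈ W, s.1 x = coord p x • t.1 x := by
  classical
  set e := trivializationAt F E p with he
  set φ := chartAt ℂ p with hφ
  have hpe : p ∈ e.baseSet := mem_baseSet_trivializationAt F E p
  let W : Opens X := ⟨U ∩ (e.baseSet ∩ φ.source),
    U.2.inter (e.open_baseSet.inter φ.open_source)⟩
  have hWφ : (W : Set X) ⊆ φ.source := fun x hx => hx.2.2
  have hWe : (W : Set X) ⊆ e.baseSet := fun x hx => hx.2.1
  have hpW : p ∈ W := ⟨hp, hpe, mem_chart_source ℂ p⟩
  let g : X → F := fun x => (e ⟨x, s.1 x⟩).2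
  have hg : ContMDiffOn 𝓘(ℂ) 𝓘(ℂ, F) ω g W :=
    (e.contMDiffOn_section_iff W.2 hWe).1 (ContMDiffOn.mono s.2.1 fun x hx => hx.1)
  have hgp : g p = 0 := by
    simp only [g, h0]
    exact congrArg Prod.snd (e.zeroSection ℂ hpe)
  have hopen : IsOpen (φ '' W) := φ.isOpen_image_of_subset_source W.2 hWφ
  have hd := contMDiffOn_chart_comp hWφ hg
  -- Removable singularity: the difference quotient of the local expression of `s`, completed at the
  -- centre by the derivative, is holomorphic. It is the quotient by `z` because `g p = 0`.
  have hd' := (Complex.differentiableOn_dslope (hopen.mem_nhds ⟨p, hpW, rfl⟩)).2 hd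
  let H : ℂ → F := dslope (g ∘ φ.symm) (φ p)
  have hH : ContMDiffOn 𝓘(ℂ) 𝓘(ℂ, F) ω (fun x => H (φ x)) W := by
    have h1 : ContDiffOn ℂ ω H (φ '' W) := (hd'.analyticOnNhd hopen).contDiffOn hopen.uniqueDiffOn
    exact (contMDiffOn_iff_contDiffOn.2 h1).comp
      ((contMDiffOn_chart (I := 𝓘(ℂ)) (n := ω) (x := p)).mono hWφ)
      (fun x hx => ⟨x, hx, rfl⟩)
  have hgH : ∀ x ∈ W, g x = coord p x • H (φ x) := fun x hx => by
    have h1 := sub_smul_dslope (g ∘ φ.symm) (φ p) (φ x)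
    simp only [Function.comp_apply, φ.left_inv (hWφ hx), φ.left_inv (hWφ hpW), hgp,
      sub_zero] at h1
    exact h1.symm
  refine ⟨W, hpW, fun x hx => hx.1, hWφ,
    ⟨fun x => if x ∈ W then e.symm x (H (φ x)) else 0, ?_, fun x hx => if_neg hx⟩,
    fun x hx => ?_⟩
  · refine (e.contMDiffOn_section_iff W.2 hWe).2 (hH.congr fun x hx => ?_)
    rw [if_pos (show x ∈ W from hx), e.apply_mk_symm (hWe hx)]
  · simp only [if_pos hx]
    have h1 : s.1 x = e.symm x (g x) := (e.symm_apply_apply_mk (hWe hx) (s.1 x)).symm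
    rw [h1, hgH x hx]
    rw [← e.coe_symmₗ (R := ℂ) (hWe hx)]
    exact (e.symmₗ ℂ x).map_smul _ _

end Division

end Local

/-! ### The local frame dual to `dz`, and bundle-valued one-forms -/

section Forms

variable {X : Type*} [TopologicalSpace X] [ChartedSpace ℂ X] [IsManifold 𝓘(ℂ) ω X]
  {F : Type*} [NormedAddCommGroup F] [NormedSpace ℂ F]
  {E : X → Type*} [TopologicalSpace (TotalSpace F E)]
  [∀ x, AddCommGroup (E x)] [∀ x, Module ℂ (E x)] [∀ x, TopologicalSpace (E x)]
  [∀ x, IsTopologicalAddGroup (E x)] [∀ x, ContinuousSMul ℂ (E x)]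
  [FiberBundle F E] [VectorBundle ℂ F E] [ContMDiffVectorBundle ω F E 𝓘(ℂ)]

/-- The holomorphic vector field near `p` that is `1` in the preferred local trivialization of
the tangent bundle at `p`. -/
noncomputable def frame (p x : X) : TangentSpace 𝓘(ℂ) x :=
  (trivializationAt ℂ (TangentSpace 𝓘(ℂ)) p).symmL ℂ x 1

theorem isHolAt_frame (p : X) {x : X} (hx : x ∈ (chartAt ℂ p).source) :
    IsHolAt ℂ (fun x : X => TangentSpace 𝓘(ℂ) x) (frame p) x := by
  set e := trivializationAt ℂ (TangentSpace 𝓘(ℂ) : X → Type _) p with he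
  have hb : e.baseSet = (chartAt ℂ p).source := TangentBundle.trivializationAt_baseSet p
  rw [← hb] at hx
  refine (e.contMDiffAt_section_iff hx).2 ?_
  refine (contMDiffAt_const (c := (1 : ℂ))).congr_of_eventuallyEq ?_
  filter_upwards [e.open_baseSet.mem_nhds hx] with y hy
  change (e ⟨y, e.symmL ℂ y 1⟩).2 = 1
  rw [e.symmL_apply hy, e.apply_mk_symm hy]

/-- Identifies `dz` with the tangent trivialization defining `frame p`. Thus `dz` and the frame are
dual on the whole chart domain, which gives `mvfderiv_coord_frame` and `smul_frame`. -/
theorem mvfderiv_coord (p : X) {x : X} (hx : x ∈ (chartAt ℂ p).source) :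
    mvfderiv 𝓘(ℂ) (coord p) x =
      (trivializationAt ℂ (TangentSpace 𝓘(ℂ)) p).continuousLinearMapAt ℂ x := by
  have h1 := TangentBundle.continuousLinearMapAt_trivializationAt (I := 𝓘(ℂ)) hx
  have hd : MDifferentiableAt 𝓘(ℂ) 𝓘(ℂ) (chartAt ℂ p) x :=
    (contMDiffOn_chart (I := 𝓘(ℂ)) (n := ω) (x := p)).contMDiffAt
      ((chartAt ℂ p).open_source.mem_nhds hx) |>.mdifferentiableAt (by simp)
  have h2 : mvfderiv 𝓘(ℂ) (coord p) x = mvfderiv 𝓘(ℂ) (chartAt ℂ p) x := by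
    have := mvfderiv_sub hd (mdifferentiableAt_const (c := chartAt ℂ p p) (I := 𝓘(ℂ)))
    rw [mvfderiv_const, sub_zero] at this
    exact this
  rw [h1, h2]
  rfl

theorem mvfderiv_coord_frame (p : X) {x : X} (hx : x ∈ (chartAt ℂ p).source) :
    mvfderiv 𝓘(ℂ) (coord p) x (frame p x) = 1 := by
  rw [mvfderiv_coord p hx]
  exact Trivialization.continuousLinearMapAt_symmL _
    (by rwa [TangentBundle.trivializationAt_baseSet]) 1

theorem smul_frame (p : X) {x : X} (hx : x ∈ (chartAt ℂ p).source) (t : TangentSpace 𝓘(ℂ) x) :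
    mvfderiv 𝓘(ℂ) (coord p) x t • frame p x = t := by
  rw [mvfderiv_coord p hx, frame, ← map_smul, smul_eq_mul, mul_one]
  exact Trivialization.symmL_continuousLinearMapAt _
    (by rwa [TangentBundle.trivializationAt_baseSet]) t

theorem contMDiffOn_coord (p : X) :
    ContMDiffOn 𝓘(ℂ) 𝓘(ℂ) ω (coord p) (chartAt ℂ p).source :=
  (contMDiffOn_chart (I := 𝓘(ℂ)) (n := ω) (x := p)).sub contMDiffOn_const

/-- A one-form is holomorphic if its value on the local frame is. -/
theorem isHolAt_hom {η : ∀ x : X, TangentSpace 𝓘(ℂ) x →L[ℂ] E x} {σ : ∀ x, E x} {p : X}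
    (hσ : IsHolAt F E σ p) (h : ∀ᶠ x in 𝓝 p, η x (frame p x) = σ x) :
    IsHolAt (ℂ →L[ℂ] F) (fun x : X => TangentSpace 𝓘(ℂ) x →L[ℂ] E x) η p := by
  refine (contMDiffAt_hom_bundle _).2 ⟨contMDiffAt_id, ?_⟩
  have h1 := (contMDiffAt_section p).1 hσ
  -- In the trivializations at `p`, `η x` becomes the linear map `ℂ → F` sending `1` to the
  -- coordinates of `η x (frame p x)`. A linear map out of `ℂ` depends continuously and linearly on
  -- its value at `1`.
  have h2 : ContMDiffAt 𝓘(ℂ) 𝓘(ℂ, ℂ →L[ℂ] F) ω (fun x =>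
      ContinuousLinearMap.smulRightL ℂ ℂ F (ContinuousLinearMap.id ℂ ℂ)
        (trivializationAt F E p ⟨x, σ x⟩).2) p :=
    (ContinuousLinearMap.contMDiff _).contMDiffAt.comp p h1
  refine h2.congr_of_eventuallyEq ?_
  filter_upwards [h, (trivializationAt F E p).open_baseSet.mem_nhds
    (mem_baseSet_trivializationAt F E p)] with x hx hb
  refine ContinuousLinearMap.ext_ring ?_
  change (trivializationAt F E p).continuousLinearMapAt ℂ x (η x (frame p x)) =
    (1 : ℂ) • (trivializationAt F E p ⟨x, σ x⟩).2
  rw [hx, one_smul, Trivialization.continuousLinearMapAt_apply,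
    Trivialization.linearMapAt_apply, if_pos hb]

theorem IsHolAt.apply {η : ∀ x : X, TangentSpace 𝓘(ℂ) x →L[ℂ] E x}
    {v : ∀ x : X, TangentSpace 𝓘(ℂ) x} {p : X}
    (hη : IsHolAt (ℂ →L[ℂ] F) (fun x : X => TangentSpace 𝓘(ℂ) x →L[ℂ] E x) η p)
    (hv : IsHolAt ℂ (fun x : X => TangentSpace 𝓘(ℂ) x) v p) :
    IsHolAt F E (fun x => η x (v x)) p :=
  ContMDiffAt.clm_bundle_apply hη hv

theorem isHolAt_coord_smulRight {σ : ∀ x, E x} {p : X} (hσ : IsHolAt F E σ p) :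
    IsHolAt (ℂ →L[ℂ] F) (fun x : X => TangentSpace 𝓘(ℂ) x →L[ℂ] E x)
      (fun x => (mvfderiv 𝓘(ℂ) (coord p) x).smulRight (σ x)) p := by
  refine isHolAt_hom hσ ?_
  filter_upwards [chart_source_mem_nhds ℂ p] with x hx
  rw [ContinuousLinearMap.smulRight_apply, mvfderiv_coord_frame p hx, one_smul]

theorem IsHolAt.add {s t : ∀ x, E x} {p : X} (hs : IsHolAt F E s p) (ht : IsHolAt F E t p) :
    IsHolAt F E (fun x => s x + t x) p :=
  ContMDiffAt.add_section hs ht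

theorem IsHolAt.smul {f : X → ℂ} {s : ∀ x, E x} {p : X} (hf : ContMDiffAt 𝓘(ℂ) 𝓘(ℂ) ω f p)
    (hs : IsHolAt F E s p) : IsHolAt F E (fun x => f x • s x) p :=
  ContMDiffAt.smul_section hf hs

theorem smulRight_coord_injective (p : X) {e e' : E p}
    (h : (mvfderiv 𝓘(ℂ) (coord p) p).smulRight e = (mvfderiv 𝓘(ℂ) (coord p) p).smulRight e') :
    e = e' := by
  have := congrArg (fun L => L (frame p p)) h
  simpa only [ContinuousLinearMap.smulRight_apply,
    mvfderiv_coord_frame p (mem_chart_source ℂ p), one_smul] using this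

/-- The residue at a simple pole is determined by the one-form near the pole. -/
theorem HasSimplePole.unique {η η' : ∀ x : X, TangentSpace 𝓘(ℂ) x →L[ℂ] E x} {p : X} {e e' : E p}
    (h : HasSimplePole F E η p e) (h' : HasSimplePole F E η' p e')
    (hη : ∀ᶠ x in 𝓝[≠] p, η x = η' x) : e = e' := by
  obtain ⟨τ, ⟨W, hW, hτ⟩, ha, hb⟩ := h
  obtain ⟨τ', ⟨W', hW', hτ'⟩, ha', hb'⟩ := h'
  refine smulRight_coord_injective p ?_
  rw [← hb, ← hb']
  refine eq_of_eventually_nhdsNE (F := ℂ →L[ℂ] F) ((isHolOn_iff W.2).1 hτ p hW)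
    ((isHolOn_iff W'.2).1 hτ' p hW') ?_
  filter_upwards [ha, ha', hη] with x h1 h2 h3
  rw [h1, h2, h3]

end Forms

/-! ### From a logarithmic connection to a splitting -/

section FromConnection

variable {X : Type*} [TopologicalSpace X] [T2Space X] [ChartedSpace ℂ X] [IsManifold 𝓘(ℂ) ω X]
  {F : Type*} [NormedAddCommGroup F] [NormedSpace ℂ F]
  {E : X → Type*} [TopologicalSpace (TotalSpace F E)]
  [∀ x, AddCommGroup (E x)] [∀ x, Module ℂ (E x)] [∀ x, TopologicalSpace (E x)]
  [∀ x, IsTopologicalAddGroup (E x)] [∀ x, ContinuousSMul ℂ (E x)]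
  [FiberBundle F E] [VectorBundle ℂ F E] [ContMDiffVectorBundle ω F E 𝓘(ℂ)]
  {S : Finset X}

theorem isOpen_sdiff (U : Opens X) (S : Finset X) : IsOpen ((U : Set X) \ S) :=
  U.2.sdiff S.finite_toSet.isClosed

theorem eventually_mem_sdiff (U : Opens X) (S : Finset X) {p : X} (hp : p ∈ U) :
    ∀ᶠ x in 𝓝[≠] p, x ∈ (U : Set X) \ S := by
  filter_upwards [eventually_notMem S p, mem_nhdsWithin_of_mem_nhds (U.2.mem_nhds hp)]
    with x hS hU using ⟨hU, hS⟩

/-- Analyticity at a point propagates to a neighbourhood, so a pole can be checked with conditions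
at `p` alone. -/
theorem hasSimplePole_iff {η : ∀ x : X, TangentSpace 𝓘(ℂ) x →L[ℂ] E x} {p : X} {e : E p} :
    HasSimplePole F E η p e ↔ ∃ τ : ∀ x : X, TangentSpace 𝓘(ℂ) x →L[ℂ] E x,
      IsHolAt (ℂ →L[ℂ] F) (fun x : X => TangentSpace 𝓘(ℂ) x →L[ℂ] E x) τ p ∧
      (∀ᶠ x in 𝓝[≠] p, τ x = coord p x • η x) ∧
      τ p = (mvfderiv 𝓘(ℂ) (coord p) p).smulRight e := by
  refine exists_congr fun τ => and_congr_left fun _ => ⟨?_, fun h => ?_⟩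
  · rintro ⟨W, hW, hτ⟩
    exact (isHolOn_iff W.2).1 hτ p hW
  · obtain ⟨u, hu, h'⟩ := (contMDiffAt_iff_contMDiffOn_nhds (by simp)).1 h
    obtain ⟨W, hWu, hW, hp⟩ := mem_nhds_iff.1 hu
    exact ⟨⟨W, hW⟩, hp, ContMDiffOn.mono h' hWu⟩

theorem LogForm.isHolAt {U : Opens X} (η : LogForm F E S U) {x : X} (hx : x ∈ (U : Set X) \ S) :
    IsHolAt (ℂ →L[ℂ] F) (fun x : X => TangentSpace 𝓘(ℂ) x →L[ℂ] E x) η.1.1 x :=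
  (isHolOn_iff (isOpen_sdiff U S)).1 η.2.1 x hx

theorem LogForm.hasSimplePole {U : Opens X} (η : LogForm F E S U) {p : X}
    (hp : p ∈ (U : Set X) ∩ S) : HasSimplePole F E η.1.1 p (η.1.2 p) :=
  η.2.2.2.1 p hp

/-- A section of `E ⊗ K_X ⊗ 𝒪_X(S)` is determined by its restriction to the complement of `S`. -/
theorem LogForm.ext_off {U : Opens X} {η θ : LogForm F E S U}
    (h : ∀ x ∈ (U : Set X) \ S, η.1.1 x = θ.1.1 x) : η = θ := by
  refine Subtype.ext (Prod.ext (funext fun x => ?_) (funext fun p => ?_))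
  · by_cases hx : x ∈ (U : Set X) \ S
    · exact h x hx
    · rw [η.2.2.1 x hx, θ.2.2.1 x hx]
  · by_cases hp : p ∈ (U : Set X) ∩ S
    · exact (LogForm.hasSimplePole η hp).unique (LogForm.hasSimplePole θ hp)
        ((eventually_mem_sdiff U S hp.1).mono fun x hx => h x hx)
    · rw [η.2.2.2.2 p hp, θ.2.2.2.2 p hp]

/-- The coordinate at `p` as a holomorphic function on an open subset of its domain. -/
noncomputable def coordHol (p : X) {W : Opens X} (hW : (W : Set X) ⊆ (chartAt ℂ p).source) : Hol W :=
  ⟨coord p, ContMDiffOn.mono (contMDiffOn_coord p) hW⟩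

namespace LogConnection

variable (D : LogConnection F E S)

/-- `app_res` concerns the one-forms off `S` only; the values over `S` follow because a one-form
determines its residue. -/
theorem app_res_snd {U W : Opens X} (h : W ≤ U) (s : Sec F E U) {p : X} (hp : p ∈ W)
    (hS : p ∈ S) : (D.app W (resSec h s)).1.2 p = (D.app U s).1.2 p :=
  (LogForm.hasSimplePole _ ⟨hp, hS⟩).unique (LogForm.hasSimplePole _ ⟨h hp, hS⟩)
    ((eventually_mem_sdiff W S hp).mono fun x hx => D.app_res U W h s x hx)

/-- Write `s = z t` near `p`. Then `D(s) = z D(t) + t ⊗ dz` is holomorphic at `p`, so `z D(s)`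
vanishes there. -/
theorem app_snd_eq_zero [CompleteSpace F] {U : Opens X} (s : Sec F E U) {p : X} (hp : p ∈ U)
    (hS : p ∈ S) (h0 : s.1 p = 0) : (D.app U s).1.2 p = 0 := by
  obtain ⟨W, hpW, hWU, hWs, t, ht⟩ := exists_eq_coord_smul s hp h0
  have hst : resSec hWU s = coordHol p hWs • t := Sec.ext_on fun x hx => by
    rw [resSec_apply hWU s hx, ht x hx]; rfl
  rw [← D.app_res_snd hWU s hpW hS, hst]
  refine (LogForm.hasSimplePole _ ⟨hpW, hS⟩).unique (η' := (D.app W (coordHol p hWs • t)).1.1) ?_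
    (Filter.Eventually.of_forall fun _ => rfl)
  obtain ⟨τ, h1, h2, h3⟩ := hasSimplePole_iff.1 (LogForm.hasSimplePole (D.app W t) ⟨hpW, hS⟩)
  have hz : ContMDiffAt 𝓘(ℂ) 𝓘(ℂ) ω (coord p) p :=
    (contMDiffOn_coord p).contMDiffAt (chart_source_mem_nhds ℂ p)
  refine hasSimplePole_iff.2 ⟨_, IsHolAt.smul (F := ℂ →L[ℂ] F) hz
    (IsHolAt.add (F := ℂ →L[ℂ] F) h1 (isHolAt_coord_smulRight (Sec.isHolAt t hpW))), ?_, ?_⟩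
  · filter_upwards [h2, eventually_mem_sdiff W S hpW] with x hx hxW
    rw [D.leibniz W _ t x hxW, hx]
    rfl
  · rw [coord_self, zero_smul]
    ext
    simp

/-- The difference of `s` and the section `constSec` with the same value at `p` vanishes at `p`, so
`app_snd_eq_zero` applies. Hence the residue does not depend on the extension chosen to define it.
-/
theorem app_snd_eq_residue [CompleteSpace F] {U : Opens X} (s : Sec F E U) {p : X} (hp : p ∈ U)
    (hS : p ∈ S) : (D.app U s).1.2 p = D.residue p (s.1 p) := by
  have hpt : p ∈ trivDomain F E p := mem_baseSet_trivializationAt F E p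
  have hp' : p ∈ U ⊓ trivDomain F E p := ⟨hp, hpt⟩
  change _ = (D.app (trivDomain F E p) (constSec F p (s.1 p))).1.2 p
  rw [← D.app_res_snd (inf_le_left : U ⊓ trivDomain F E p ≤ U) s hp' hS,
    ← D.app_res_snd (inf_le_right : U ⊓ trivDomain F E p ≤ _) _ hp' hS, ← sub_eq_zero]
  have h := D.app_snd_eq_zero (resSec (inf_le_left : U ⊓ trivDomain F E p ≤ U) s -
    resSec (inf_le_right : U ⊓ trivDomain F E p ≤ _) (constSec F p (s.1 p))) hp' hS (by
      change (resSec _ s).1 p - (resSec _ (constSec F p (s.1 p))).1 p = 0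
      rw [resSec_apply _ _ hp', resSec_apply _ _ hp', constSec_apply_self, sub_self])
  rw [map_sub] at h
  exact h

/-- With `v = z w` near `p`, `⟨D(s), v⟩ = ⟨z D(s), w⟩`, and `z D(s)` is holomorphic with a known
value at `p`. The constant `dz(w(p))` depends on `v` but not on `s` or its domain, so the pairing at
`p` is linear in `s(p)`. -/
theorem exists_local_pairing {U : Opens X} (v : TanLog S U) {p : X} (hp : p ∈ U) (hS : p ∈ S) :
    ∃ c : ℂ, ∀ (W : Opens X) (_ : p ∈ W) (s : Sec F E W), ∃ t : ∀ x, E x, IsHolAt F E t p ∧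
      (∀ᶠ x in 𝓝[≠] p, t x = (D.app W s).1.1 x (v.1.1 x)) ∧ t p = c • (D.app W s).1.2 p := by
  obtain ⟨V, hpV, hVU, -, w, hw⟩ := exists_eq_coord_smul v.1 hp (v.2 p hS)
  refine ⟨mvfderiv 𝓘(ℂ) (coord p) p (w.1 p), fun W hpW s => ?_⟩
  obtain ⟨τ, h1, h2, h3⟩ := hasSimplePole_iff.1 (LogForm.hasSimplePole (D.app W s) ⟨hpW, hS⟩)
  refine ⟨fun x => τ x (w.1 x), h1.apply (Sec.isHolAt w hpV), ?_, ?_⟩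
  · filter_upwards [h2, mem_nhdsWithin_of_mem_nhds (V.2.mem_nhds hpV)] with x hx hV
    rw [hx, hw x hV, map_smul]
    rfl
  · simp only [h3]
    rfl

theorem exists_pairing {U : Opens X} (v : TanLog S U) (W : Opens X) (hW : W ≤ U)
    (s : Sec F E W) :
    ∃ T : Sec F E W, ∀ x ∈ (W : Set X) \ S, T.1 x = (D.app W s).1.1 x (v.1.1 x) := by
  refine exists_sec_extension _ (fun x hx => ?_) fun p hp => ?_
  · exact (LogForm.isHolAt _ hx).apply (Sec.isHolAt v.1 (hW hx.1))
  · obtain ⟨c, hc⟩ := D.exists_local_pairing v (hW hp.1) hp.2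
    obtain ⟨t, h1, h2, -⟩ := hc W hp.1 s
    exact ⟨t, h1, h2⟩

/-- The operator `s ↦ ⟨D(s), v⟩`. -/
noncomputable def pairing {U : Opens X} (v : TanLog S U) : RawOp F E U := fun W =>
  { toFun := fun s => (D.exists_pairing v W.1 W.2 s).choose
    map_add' := fun s t => Sec.ext_off (S := S) fun x hx => by
      change _ = (D.exists_pairing v W.1 W.2 s).choose.1 x +
        (D.exists_pairing v W.1 W.2 t).choose.1 x
      rw [(D.exists_pairing v W.1 W.2 s).choose_spec x hx,
        (D.exists_pairing v W.1 W.2 t).choose_spec x hx,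
        (D.exists_pairing v W.1 W.2 (s + t)).choose_spec x hx, map_add]
      rfl
    map_smul' := fun c s => Sec.ext_off (S := S) fun x hx => by
      change _ = c • (D.exists_pairing v W.1 W.2 s).choose.1 x
      rw [(D.exists_pairing v W.1 W.2 s).choose_spec x hx,
        (D.exists_pairing v W.1 W.2 (c • s)).choose_spec x hx, map_smul]
      rfl }

theorem pairing_apply {U W : Opens X} (hW : W ≤ U) (v : TanLog S U) (s : Sec F E W) {x : X}
    (hx : x ∈ (W : Set X) \ S) :
    (D.pairing v ⟨W, hW⟩ s).1 x = (D.app W s).1.1 x (v.1.1 x) :=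
  (D.exists_pairing v W hW s).choose_spec x hx

/-- At a point of `S`, the pairing with `v` is a multiple of the residue. -/
theorem exists_pairing_eq_smul_residue [CompleteSpace F] {U : Opens X} (v : TanLog S U) {p : X}
    (hp : p ∈ U) (hS : p ∈ S) : ∃ c : ℂ, ∀ (W : Opens X) (hW : W ≤ U) (_ : p ∈ W)
      (s : Sec F E W), (D.pairing v ⟨W, hW⟩ s).1 p = c • D.residue p (s.1 p) := by
  obtain ⟨c, hc⟩ := D.exists_local_pairing v hp hS
  refine ⟨c, fun W hW hpW s => ?_⟩
  obtain ⟨t, h1, h2, h3⟩ := hc W hpW s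
  rw [← D.app_snd_eq_residue s hpW hS, ← h3]
  refine eq_of_eventually_nhdsNE (Sec.isHolAt _ hpW) h1 ?_
  filter_upwards [h2, eventually_mem_sdiff W S hpW] with x hx hxW
  rw [hx, D.pairing_apply hW v s hxW]

theorem hasSymbol_pairing [CompleteSpace F] {U : Opens X} (v : TanLog S U) :
    HasSymbol (D.pairing v) v.1 := by
  intro W hW f s x hx
  change (D.pairing v ⟨W, hW⟩ (f • s)).1 x - f.1 x • (D.pairing v ⟨W, hW⟩ s).1 x = _
  by_cases hS : x ∈ S
  -- At a point of `S` the operator acts through a linear map of the fibre, so it commutes with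
  -- multiplication by `f` there; the other side is zero because `v` vanishes.
  · obtain ⟨c, hc⟩ := D.exists_pairing_eq_smul_residue v (hW hx) hS
    rw [hc W hW hx, hc W hW hx, v.2 x hS, map_zero, zero_smul]
    change c • D.residue x (f.1 x • s.1 x) - _ = 0
    rw [map_smul, smul_comm, sub_self]
  · rw [D.pairing_apply hW v _ ⟨hx, hS⟩, D.pairing_apply hW v _ ⟨hx, hS⟩,
      D.leibniz W f s x ⟨hx, hS⟩]
    change f.1 x • (D.app W s).1.1 x (v.1.1 x) + mvfderiv 𝓘(ℂ) f.1 x (v.1.1 x) • s.1 x - _ = _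
    rw [add_sub_cancel_left]

theorem isOrderOne_of_hasSymbol {U : Opens X} {A : RawOp F E U}
    {v : Sec ℂ (fun x : X => TangentSpace 𝓘(ℂ) x) U} (h : HasSymbol A v) : IsOrderOne A := by
  intro W hW f g s
  refine Sec.ext_on fun x hx => ?_
  change _ = g.1 x • (symbol A W hW f s).1 x
  rw [h W hW f _ x hx, h W hW f s x hx, smul_comm]
  rfl

theorem isSheafHom_pairing {U : Opens X} (v : TanLog S U) : IsSheafHom (D.pairing v) := by
  intro W hW V hV s
  refine Sec.ext_off (S := S) fun x hx => ?_
  rw [D.pairing_apply _ v _ hx, resSec_apply hV _ hx.1, D.pairing_apply hW v s ⟨hV hx.1, hx.2⟩,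
    D.app_res W V hV s x hx]

theorem preservesFlagSec_pairing [CompleteSpace F] {P : ParabolicStructure E S}
    (hD : D.PreservesFlags P) {U : Opens X} (v : TanLog S U) :
    PreservesFlagSec P (D.pairing v) := by
  intro p j W hW s hs hp
  obtain ⟨c, hc⟩ := D.exists_pairing_eq_smul_residue v (hW hp) p.2
  rw [hc W hW hp s]
  exact Submodule.smul_mem _ c (hD p j _ (hs hp))

/-- The splitting of the parabolic Atiyah sequence defined by a logarithmic connection whose
residues preserve the flags. -/
noncomputable def splitting [CompleteSpace F] {P : ParabolicStructure E S}
    (hD : D.PreservesFlags P) : AtiyahSplitting F P where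
  app U :=
    { toFun := fun v => ⟨D.pairing v, ⟨⟨D.isSheafHom_pairing v,
        isOrderOne_of_hasSymbol (D.hasSymbol_pairing v)⟩, D.preservesFlagSec_pairing hD v⟩,
        v, D.hasSymbol_pairing v⟩
      map_add' := fun v w => Subtype.ext <| funext fun W => LinearMap.ext fun s =>
        Sec.ext_off (S := S) fun x hx => by
          change (D.pairing (v + w) W s).1 x = (D.pairing v W s).1 x + (D.pairing w W s).1 x
          rw [D.pairing_apply W.2 _ _ hx, D.pairing_apply W.2 _ _ hx, D.pairing_apply W.2 _ _ hx,
            ← map_add]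
          rfl
      map_smul' := fun f v => Subtype.ext <| funext fun W => LinearMap.ext fun s =>
        Sec.ext_off (S := S) fun x hx => by
          change (D.pairing (f • v) W s).1 x = f.1 x • (D.pairing v W s).1 x
          rw [D.pairing_apply W.2 _ _ hx, D.pairing_apply W.2 _ _ hx, ← map_smul]
          rfl }
  app_res U W h v := funext fun V => LinearMap.ext fun s => Sec.ext_off (S := S) fun x hx => by
    change (D.pairing (resTan h v) V s).1 x = (D.pairing v ⟨V.1, V.2.trans h⟩ s).1 x
    rw [D.pairing_apply V.2 _ _ hx, D.pairing_apply (V.2.trans h) _ _ hx]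
    change (D.app V.1 s).1.1 x ((resSec h v.1).1 x) = _
    rw [resSec_apply h _ (V.2 hx.1)]
  symbol_app U v := D.hasSymbol_pairing v

end LogConnection

end FromConnection

/-! ### The vector fields `∂/∂z` and `z ∂/∂z` as sections of `TX(-S)` -/

section Frames

variable {X : Type*} [TopologicalSpace X] [T2Space X] [ChartedSpace ℂ X] [IsManifold 𝓘(ℂ) ω X]

/-- The domain of the preferred chart at `p`, with the points of `A` removed. -/
def chartDomain (p : X) (A : Finset X) : Opens X :=
  ⟨(chartAt ℂ p).source \ A, (chartAt ℂ p).open_source.sdiff A.finite_toSet.isClosed⟩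

theorem chartDomain_subset (p : X) (A : Finset X) :
    (chartDomain p A : Set X) ⊆ (chartAt ℂ p).source := fun _ hx => hx.1

open Classical in
/-- The local frame `∂/∂z` as a section of the tangent bundle. -/
noncomputable def frameSec (p : X) (A : Finset X) :
    Sec ℂ (fun x : X => TangentSpace 𝓘(ℂ) x) (chartDomain p A) :=
  ⟨fun x => if x ∈ chartDomain p A then frame p x else 0,
    (isHolOn_iff (chartDomain p A).2).2 fun x hx => (isHolAt_frame p hx.1).congr <| by
      filter_upwards [(chartDomain p A).2.mem_nhds hx] with y hy using if_pos hy,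
    fun _ hx => if_neg hx⟩

theorem frameSec_apply {p x : X} {A : Finset X} (hx : x ∈ chartDomain p A) :
    (frameSec p A).1 x = frame p x := if_pos hx

/-- The vector field `∂/∂z` on the complement of `S` in a chart. -/
noncomputable def frameOff (S : Finset X) (p : X) : TanLog S (chartDomain p S) :=
  -- The points of `S` lie outside the domain, where sections are extended by zero, so the vanishing
  -- condition costs nothing.
  ⟨frameSec p S, fun _ hq => (frameSec p S).2.2 _ fun h => h.2 hq⟩

open Classical in
/-- The vector field `z ∂/∂z` in a chart centred at `p`, away from the other points of `S`. -/
noncomputable def polarFrame (S : Finset X) (p : X) : TanLog S (chartDomain p (S.erase p)) :=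
  ⟨coordHol p (chartDomain_subset p (S.erase p)) • frameSec p (S.erase p), fun q hq => by
    change coord p q • (frameSec p (S.erase p)).1 q = 0
    by_cases h : q = p
    · rw [h, coord_self, zero_smul]
    · rw [(frameSec p (S.erase p)).2.2 q fun h' => h'.2 (Finset.mem_erase.2 ⟨h, hq⟩), smul_zero]⟩

theorem mem_chartDomain_self {p : X} {A : Finset X} (h : p ∉ A) : p ∈ chartDomain p A :=
  ⟨mem_chart_source ℂ p, h⟩

end Frames

/-! ### From a splitting to a logarithmic connection -/

section FromSplitting

variable {X : Type*} [TopologicalSpace X] [T2Space X] [ChartedSpace ℂ X] [IsManifold 𝓘(ℂ) ω X]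
  {F : Type*} [NormedAddCommGroup F] [NormedSpace ℂ F]
  {E : X → Type*} [TopologicalSpace (TotalSpace F E)]
  [∀ x, AddCommGroup (E x)] [∀ x, Module ℂ (E x)] [∀ x, TopologicalSpace (E x)]
  [∀ x, IsTopologicalAddGroup (E x)] [∀ x, ContinuousSMul ℂ (E x)]
  [FiberBundle F E] [VectorBundle ℂ F E] [ContMDiffVectorBundle ω F E 𝓘(ℂ)]
  {S : Finset X} {P : ParabolicStructure E S}

theorem resSec_add {U W : Opens X} (h : W ≤ U) (s t : Sec F E U) :
    resSec h (s + t) = resSec h s + resSec h t := Sec.ext_on fun x hx => by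
  change _ = (resSec h s).1 x + (resSec h t).1 x
  rw [resSec_apply h _ hx, resSec_apply h _ hx, resSec_apply h _ hx]
  rfl

theorem resSec_smul {U W : Opens X} (h : W ≤ U) (c : ℂ) (s : Sec F E U) :
    resSec h (c • s) = c • resSec h s := Sec.ext_on fun x hx => by
  change _ = c • (resSec h s).1 x
  rw [resSec_apply h _ hx, resSec_apply h _ hx]
  rfl

theorem resSec_smul_hol {U W : Opens X} (h : W ≤ U) (f : Hol U) (s : Sec F E U) :
    resSec h (f • s) = resHol h f • resSec h s := Sec.ext_on fun x hx => by
  change _ = f.1 x • (resSec h s).1 x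
  rw [resSec_apply h _ hx, resSec_apply h _ hx]
  rfl

namespace AtiyahSplitting

variable (h : AtiyahSplitting F P)

theorem isSheafHom {U : Opens X} (v : TanLog S U) : IsSheafHom (h.app U v).1 :=
  (h.app U v).2.1.1.1

theorem app_apply_eq_res {U U' W V : Opens X} (v : TanLog S U) (hW : W ≤ U) (s : Sec F E W)
    (hU' : U' ≤ U) (hVU : V ≤ U') (hVW : V ≤ W) {x : X} (hx : x ∈ V) :
    ((h.app U v).1 ⟨W, hW⟩ s).1 x =
      ((h.app U' (resTan hU' v)).1 ⟨V, hVU⟩ (resSec hVW s)).1 x := by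
  rw [h.app_res U U' hU' v]
  change _ = ((h.app U v).1 ⟨V, _⟩ (resSec hVW s)).1 x
  rw [h.isSheafHom v W hW V hVW s, resSec_apply hVW _ hx]

/-- `h(v)(s)` vanishes at the points outside `S` where `v` does. -/
theorem app_apply_eq_zero {U W : Opens X} (v : TanLog S U) (hW : W ≤ U) (s : Sec F E W) {x : X}
    (hx : x ∈ (W : Set X) \ S) (h0 : v.1.1 x = 0) : ((h.app U v).1 ⟨W, hW⟩ s).1 x = 0 := by
  obtain ⟨V, hxV, hVU, hVs, w, hw⟩ := exists_eq_coord_smul v.1 (hW hx.1) h0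
  let V' : Opens X := V ⊓ ⟨(W : Set X) \ S, isOpen_sdiff W S⟩
  have hV'V : V' ≤ V := inf_le_left
  have hxV' : x ∈ V' := ⟨hxV, hx⟩
  -- The quotient field `w` need not vanish on `S`, but shrinking to an open set that misses `S`
  -- puts it in the domain of `h`, so that linearity over the coordinate can be used.
  let w' : TanLog S V' := ⟨resSec hV'V w, fun q hq => (resSec hV'V w).2.2 q fun h' => h'.2.2 hq⟩
  have hvw : resTan (hV'V.trans hVU) v = coordHol x (fun y hy => hVs (hV'V hy)) • w' :=
    Subtype.ext <| Sec.ext_on fun y hy => by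
      change (resSec (hV'V.trans hVU) v.1).1 y = coord x y • (resSec hV'V w).1 y
      rw [resSec_apply _ _ hy, resSec_apply _ _ hy, hw y (hV'V hy)]
  rw [h.app_apply_eq_res v hW s (hV'V.trans hVU) le_rfl (fun y hy => hy.2.1) hxV', hvw, map_smul]
  change coord x x • _ = _
  rw [coord_self, zero_smul]

/-- Pointwise dependence on the vector field: restrict everything to `W ⊓ W'` and apply
`app_apply_eq_zero` to the difference of the two fields, which vanishes at `x`. -/
theorem app_apply_congr {U U' W W' : Opens X} (v : TanLog S U) (v' : TanLog S U') (hW : W ≤ U)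
    (hW' : W' ≤ U') (s : Sec F E W) (s' : Sec F E W') {x : X} (hx : x ∈ W) (hx' : x ∈ W')
    (hS : x ∉ S) (hv : v.1.1 x = v'.1.1 x) (hs : ∀ y ∈ W ⊓ W', s.1 y = s'.1 y) :
    ((h.app U v).1 ⟨W, hW⟩ s).1 x = ((h.app U' v').1 ⟨W', hW'⟩ s').1 x := by
  have hVU : W ⊓ W' ≤ U := inf_le_left.trans hW
  have hVU' : W ⊓ W' ≤ U' := inf_le_right.trans hW'
  have hxV : x ∈ W ⊓ W' := ⟨hx, hx'⟩
  rw [h.app_apply_eq_res v hW s hVU le_rfl inf_le_left hxV,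
    h.app_apply_eq_res v' hW' s' hVU' le_rfl inf_le_right hxV,
    show resSec (inf_le_left : W ⊓ W' ≤ W) s = resSec (inf_le_right : W ⊓ W' ≤ W') s' from
      Sec.ext_on fun y hy => by rw [resSec_apply _ _ hy, resSec_apply _ _ hy, hs y hy]]
  let u : TanLog S (W ⊓ W') := resTan hVU v - resTan hVU' v'
  have hu : resTan hVU v = u + resTan hVU' v' := Subtype.ext <| Subtype.ext <|
    funext fun y => (sub_add_cancel ((resTan hVU v).1.1 y) ((resTan hVU' v').1.1 y)).symm
  have h1 := h.app_apply_eq_zero u le_rfl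
    (resSec (inf_le_right : W ⊓ W' ≤ W') s') (x := x) ⟨hxV, hS⟩ (by
      change (resSec hVU v.1).1 x - (resSec hVU' v'.1).1 x = 0
      rw [resSec_apply _ _ hxV, resSec_apply _ _ hxV, hv, sub_self])
  rw [hu, map_add]
  refine Eq.trans ?_ (zero_add _)
  rw [← h1]
  rfl

/-- The derivative of `s` along the frame `∂/∂z` at `p`. -/
noncomputable def alongFrame (p : X) {U : Opens X} (s : Sec F E U) :
    Sec F E (chartDomain p S ⊓ U) :=
  (h.app (chartDomain p S) (frameOff S p)).1 ⟨chartDomain p S ⊓ U, inf_le_left⟩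
    (resSec inf_le_right s)

open Classical in
/-- The derivative of `s` along the logarithmic frame `z ∂/∂z` at `p`. -/
noncomputable def alongPolarFrame (p : X) {U : Opens X} (s : Sec F E U) :
    Sec F E (chartDomain p (S.erase p) ⊓ U) :=
  (h.app _ (polarFrame S p)).1 ⟨chartDomain p (S.erase p) ⊓ U, inf_le_left⟩
    (resSec inf_le_right s)

open Classical in
/-- The one-form off `S` defined by a section. -/
noncomputable def oneForm {U : Opens X} (s : Sec F E U) (x : X) :
    TangentSpace 𝓘(ℂ) x →L[ℂ] E x :=
  if x ∈ (U : Set X) \ S then (mvfderiv 𝓘(ℂ) (coord x) x).smulRight ((h.alongFrame x s).1 x) else 0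

theorem oneForm_of_mem {U : Opens X} (s : Sec F E U) {x : X} (hx : x ∈ (U : Set X) \ S) :
    h.oneForm s x = (mvfderiv 𝓘(ℂ) (coord x) x).smulRight ((h.alongFrame x s).1 x) := if_pos hx

/-- Frees `oneForm` from its definition, which uses a different coordinate at every point: any field
may be used to evaluate it. -/
theorem oneForm_apply {U U' W : Opens X} (s : Sec F E U) (v : TanLog S U') (hWU : W ≤ U)
    (hWU' : W ≤ U') {x : X} (hx : x ∈ (W : Set X) \ S) :
    h.oneForm s x (v.1.1 x) = ((h.app U' v).1 ⟨W, hWU'⟩ (resSec hWU s)).1 x := by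
  have hxD : x ∈ chartDomain x S := mem_chartDomain_self hx.2
  rw [h.oneForm_of_mem s ⟨hWU hx.1, hx.2⟩, ContinuousLinearMap.smulRight_apply]
  -- A constant multiple of `∂/∂z` with the same value at `x` as `v`; by `app_apply_congr` only this
  -- value matters.
  let c : Hol (chartDomain x S) :=
    ⟨fun _ => mvfderiv 𝓘(ℂ) (coord x) x (v.1.1 x), contMDiffOn_const⟩
  have h1 : mvfderiv 𝓘(ℂ) (coord x) x (v.1.1 x) • (h.alongFrame x s).1 x =
      ((h.app (chartDomain x S) (c • frameOff S x)).1 ⟨chartDomain x S ⊓ U, inf_le_left⟩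
        (resSec inf_le_right s)).1 x := by
    rw [map_smul]
    rfl
  rw [h1]
  refine h.app_apply_congr _ _ _ _ _ _ ⟨hxD, hWU hx.1⟩ hx.1 hx.2 ?_ fun y hy => ?_
  · change mvfderiv 𝓘(ℂ) (coord x) x (v.1.1 x) • (frameSec x S).1 x = _
    rw [frameSec_apply hxD, smul_frame x (mem_chart_source ℂ x)]
  · rw [resSec_apply _ _ hy.1, resSec_apply _ _ hy.2]

/-- On a whole neighbourhood of `x`, evaluation on the single frame `∂/∂z` centred at `x` gives the
holomorphic section `alongFrame x s`. -/
theorem isHolAt_oneForm {U : Opens X} (s : Sec F E U) {x : X} (hx : x ∈ (U : Set X) \ S) :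
    IsHolAt (ℂ →L[ℂ] F) (fun x : X => TangentSpace 𝓘(ℂ) x →L[ℂ] E x) (h.oneForm s) x := by
  have hxD : x ∈ chartDomain x S ⊓ U := ⟨mem_chartDomain_self hx.2, hx.1⟩
  refine isHolAt_hom (Sec.isHolAt (h.alongFrame x s) hxD) ?_
  filter_upwards [(chartDomain x S ⊓ U).2.mem_nhds hxD] with y hy
  have h1 := h.oneForm_apply s (frameOff S x) inf_le_right inf_le_left (x := y)
    (W := chartDomain x S ⊓ U) ⟨hy, hy.1.2⟩
  change h.oneForm s y ((frameSec x S).1 y) = _ at h1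
  rw [frameSec_apply hy.1] at h1
  exact h1

/-- Since `η(z ∂/∂z) = h(z ∂/∂z)(s)` off `S`, duality gives `z η = dz ⊗ h(z ∂/∂z)(s)`, whose right
side is holomorphic at `p`. -/
theorem hasSimplePole_oneForm {U : Opens X} (s : Sec F E U) {p : X} (hp : p ∈ U) :
    HasSimplePole F E (h.oneForm s) p ((h.alongPolarFrame p s).1 p) := by
  classical
  have hpD : p ∈ chartDomain p (S.erase p) ⊓ U :=
    ⟨mem_chartDomain_self (Finset.notMem_erase p S), hp⟩
  refine hasSimplePole_iff.2
    ⟨_, isHolAt_coord_smulRight (Sec.isHolAt (h.alongPolarFrame p s) hpD), ?_, rfl⟩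
  filter_upwards [eventually_mem_sdiff _ S hpD] with x hx
  have h1 := h.oneForm_apply s (polarFrame S p) inf_le_right inf_le_left hx
  change h.oneForm s x (coord p x • (frameSec p _).1 x) = (h.alongPolarFrame p s).1 x at h1
  rw [frameSec_apply hx.1.1, map_smul] at h1
  refine ContinuousLinearMap.ext fun t => ?_
  rw [ContinuousLinearMap.smulRight_apply, ← h1, smul_apply, smul_comm,
    ← map_smul, smul_frame p hx.1.1.1]

open Classical in
/-- The section of `E ⊗ K_X ⊗ 𝒪_X(S)` defined by a section of `E`. -/
noncomputable def logForm {U : Opens X} (s : Sec F E U) : LogForm F E S U :=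
  ⟨(h.oneForm s, fun p => if p ∈ (U : Set X) ∩ S then (h.alongPolarFrame p s).1 p else 0),
    (isHolOn_iff (isOpen_sdiff U S)).2 fun _ hx => h.isHolAt_oneForm s hx,
    fun _ hx => if_neg hx,
    fun p hp => by
      simp only [if_pos hp]
      exact h.hasSimplePole_oneForm s hp.1,
    fun _ hx => if_neg hx⟩

/-- The logarithmic connection defined by a splitting of the parabolic Atiyah sequence. -/
noncomputable def connection : LogConnection F E S where
  app U :=
    { toFun := fun s => h.logForm s
      map_add' := fun s t => LogForm.ext_off fun x hx => by
        change h.oneForm (s + t) x = h.oneForm s x + h.oneForm t x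
        rw [h.oneForm_of_mem _ hx, h.oneForm_of_mem _ hx, h.oneForm_of_mem _ hx, alongFrame,
          resSec_add, map_add]
        refine ContinuousLinearMap.ext fun v => ?_
        exact smul_add _ ((h.alongFrame x s).1 x) ((h.alongFrame x t).1 x)
      map_smul' := fun c s => LogForm.ext_off fun x hx => by
        change h.oneForm (c • s) x = c • h.oneForm s x
        rw [h.oneForm_of_mem _ hx, h.oneForm_of_mem _ hx, alongFrame, resSec_smul, map_smul]
        refine ContinuousLinearMap.ext fun v => ?_
        exact smul_comm _ c ((h.alongFrame x s).1 x) }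
  app_res U W hW s x hx := by
    change h.oneForm (resSec hW s) x = h.oneForm s x
    have hxD : x ∈ chartDomain x S := mem_chartDomain_self hx.2
    rw [h.oneForm_of_mem _ hx, h.oneForm_of_mem _ ⟨hW hx.1, hx.2⟩, alongFrame, alongFrame]
    congr 1
    refine h.app_apply_congr _ _ _ _ _ _ ⟨hxD, hx.1⟩ ⟨hxD, hW hx.1⟩ hx.2 rfl fun y hy => ?_
    rw [resSec_apply _ _ hy.1, resSec_apply _ _ hy.2, resSec_apply _ _ hy.1.2]
  leibniz U f s x hx := by
    change h.oneForm (f • s) x = f.1 x • h.oneForm s x + _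
    have hxD : x ∈ chartDomain x S := mem_chartDomain_self hx.2
    have h1 := h.symbol_app _ (frameOff S x) (chartDomain x S ⊓ U) inf_le_left
      (resHol inf_le_right f) (resSec inf_le_right s) x ⟨hxD, hx.1⟩
    rw [resSec_apply _ _ (show x ∈ chartDomain x S ⊓ U from ⟨hxD, hx.1⟩), symbol,
      ← resSec_smul_hol] at h1
    change (h.alongFrame x (f • s)).1 x - f.1 x • (h.alongFrame x s).1 x =
      mvfderiv 𝓘(ℂ) f.1 x ((frameSec x S).1 x) • s.1 x at h1
    rw [frameSec_apply hxD, sub_eq_iff_eq_add'] at h1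
    rw [h.oneForm_of_mem _ hx, h.oneForm_of_mem _ hx, h1]
    refine ContinuousLinearMap.ext fun t => ?_
    change mvfderiv 𝓘(ℂ) (coord x) x t • (_ + _) =
      f.1 x • (mvfderiv 𝓘(ℂ) (coord x) x t • _) + mvfderiv 𝓘(ℂ) f.1 x t • s.1 x
    -- The commutator of `h(∂/∂z)` with `f` is `df(∂/∂z)`, and `dz(t) df(∂/∂z) = df(t)` because
    -- `dz(t) ∂/∂z = t`.
    rw [smul_add, smul_comm (f.1 x), ← smul_assoc _ (mvfderiv 𝓘(ℂ) f.1 x _), ← map_smul,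
      smul_frame x (mem_chart_source ℂ x)]

theorem connection_apply {U W : Opens X} (hW : W ≤ U) (v : TanLog S U) (s : Sec F E W) {x : X}
    (hx : x ∈ (W : Set X) \ S) :
    (h.connection.app W s).1.1 x (v.1.1 x) = ((h.app U v).1 ⟨W, hW⟩ s).1 x := by
  have h1 := h.oneForm_apply s v le_rfl hW hx
  rwa [show resSec le_rfl s = s from Sec.ext_on fun y hy => resSec_apply _ s hy] at h1

/-- The residue of `e` is the value at `p` of `h(z ∂/∂z)` applied to a section through `e`. If `e`
lies in a flag space, that section lies in the corresponding subsheaf, which `h(z ∂/∂z)` preserves.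
-/
theorem preservesFlags_connection : h.connection.PreservesFlags P := by
  classical
  intro p j e he
  have hpt : p.1 ∈ trivDomain F E p.1 := mem_baseSet_trivializationAt F E p.1
  have hpD : p.1 ∈ chartDomain p.1 (S.erase p.1) ⊓ trivDomain F E p.1 :=
    ⟨mem_chartDomain_self (Finset.notMem_erase _ S), hpt⟩
  have h1 : h.connection.residue p.1 e = (h.alongPolarFrame p.1 (constSec F p.1 e)).1 p.1 :=
    if_pos ⟨hpt, p.2⟩
  rw [h1]
  refine (h.app _ (polarFrame S p.1)).2.1.2 p j _ _ _ (fun _ => ?_) hpD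
  rwa [resSec_apply _ _ hpD, constSec_apply_self]

end AtiyahSplitting

/-! ### Uniqueness on both sides of the correspondence, and the bijection -/

/-- `h(v)(s) = ⟨D(s), v⟩` for all local sections `v` of `TX(-S)` and `s` of `E`. -/
def Corresponds (h : AtiyahSplitting F P) (D : LogConnection F E S) : Prop :=
  ∀ (U W : Opens X) (hW : W ≤ U) (v : TanLog S U) (s : Sec F E W), ∀ x ∈ (W : Set X) \ S,
    (D.app W s).1.1 x (v.1.1 x) = ((h.app U v).1 ⟨W, hW⟩ s).1 x

theorem Corresponds.splitting_unique {h h' : AtiyahSplitting F P} {D : LogConnection F E S}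
    (H : Corresponds h D) (H' : Corresponds h' D) : h = h' := by
  have : h.app = h'.app := funext fun U => LinearMap.ext fun v => Subtype.ext <|
    funext fun W => LinearMap.ext fun s => Sec.ext_off (S := S) fun x hx =>
      (H U W.1 W.2 v s x hx).symm.trans (H' U W.1 W.2 v s x hx)
  cases h
  cases h'
  cases this
  rfl

/-- At each `x ∉ S` the field `∂/∂z` spans the tangent line, so the formula fixes the one-form of
`D(s)` there. -/
theorem Corresponds.connection_unique {h : AtiyahSplitting F P} {D D' : LogConnection F E S}
    (H : Corresponds h D) (H' : Corresponds h D') : D = D' := by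
  have : D.app = D'.app := funext fun U => LinearMap.ext fun s => LogForm.ext_off fun x hx => by
    have hxD : x ∈ chartDomain x S := mem_chartDomain_self hx.2
    have hx' : x ∈ ((chartDomain x S ⊓ U : Opens X) : Set X) \ S := ⟨⟨hxD, hx.1⟩, hx.2⟩
    have h1 := (H _ _ inf_le_left (frameOff S x) (resSec inf_le_right s) x hx').trans
      (H' _ _ inf_le_left (frameOff S x) (resSec inf_le_right s) x hx').symm
    rw [D.app_res _ _ inf_le_right s x hx', D'.app_res _ _ inf_le_right s x hx'] at h1
    change (D.app U s).1.1 x ((frameSec x S).1 x) = (D'.app U s).1.1 x ((frameSec x S).1 x) at h1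
    rw [frameSec_apply hxD] at h1
    refine ContinuousLinearMap.ext fun t => ?_
    rw [← smul_frame x (mem_chart_source ℂ x) t, map_smul, map_smul, h1]
  cases D
  cases D'
  cases this
  rfl

end FromSplitting

end ParabolicAtiyah

theorem lemma1
    {X : Type*} [TopologicalSpace X] [T2Space X] [CompactSpace X] [ConnectedSpace X]
    [ChartedSpace ℂ X] [IsManifold 𝓘(ℂ) ω X]
    {F : Type*} [NormedAddCommGroup F] [NormedSpace ℂ F] [FiniteDimensional ℂ F]
    {E : X → Type*} [TopologicalSpace (TotalSpace F E)]
    [∀ x, AddCommGroup (E x)] [∀ x, Module ℂ (E x)] [∀ x, TopologicalSpace (E x)]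
    [∀ x, IsTopologicalAddGroup (E x)] [∀ x, ContinuousSMul ℂ (E x)]
    [FiberBundle F E] [VectorBundle ℂ F E] [ContMDiffVectorBundle ω F E 𝓘(ℂ)]
    {S : Finset X} (P : ParabolicAtiyah.ParabolicStructure E S) :
    ∃ Φ : ParabolicAtiyah.AtiyahSplitting F P ≃
        {D : ParabolicAtiyah.LogConnection F E S // D.PreservesFlags P},
      ∀ (h : ParabolicAtiyah.AtiyahSplitting F P) (U W : Opens X) (hW : W ≤ U)
        (v : ParabolicAtiyah.TanLog S U) (s : ParabolicAtiyah.Sec F E W),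
        ∀ x ∈ (W : Set X) \ S,
          ((Φ h).1.app W s).1.1 x (v.1.1 x) = ((h.app U v).1 ⟨W, hW⟩ s).1 x := by
  -- Completeness of the model fibre is what division by the coordinate requires.
  have : CompleteSpace F := FiniteDimensional.complete ℂ F
  have hD : ∀ D : {D : ParabolicAtiyah.LogConnection F E S // D.PreservesFlags P},
      ParabolicAtiyah.Corresponds (D.1.splitting D.2) D.1 :=
    fun D U W hW v s x hx => (D.1.pairing_apply hW v s hx).symm
  have hh : ∀ h : ParabolicAtiyah.AtiyahSplitting F P,
      ParabolicAtiyah.Corresponds h h.connection :=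
    fun h U W hW v s x hx => h.connection_apply hW v s hx
  exact ⟨{
    toFun := fun h => ⟨h.connection, h.preservesFlags_connection⟩
    invFun := fun D => D.1.splitting D.2
    left_inv := fun h => (hD ⟨h.connection, h.preservesFlags_connection⟩).splitting_unique (hh h)
    right_inv := fun D => Subtype.ext ((hh (D.1.splitting D.2)).connection_unique (hD D)) }, hh⟩
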